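/- Let $S=R\cup B$ be a finite set of points in the plane, where $R$ (red points) and $B$ (blue points) are disjoint. $S$ is balanced with $2n$ points if $|R|=|B|=n$. $S$ is in strong general position if no three points of $S$ are collinear and no two different pairs of points of $S$ span parallel lines. Choose for every point $p\in S$ a ray with apex $p$, such that the rays are pairwise disjoint, and give each ray the color of its apex. These rays induce at infinity a circular sequence of colors, namely the colors of the rays in the clockwise order in which they meet a circle that encloses $S$. A circular sequence of $n$ red and $n$ blue elements (considered up to rotation) is feasible from $S$ if it arises in this way from some pairwise-disjoint rays from $S$. Let $\gamma(S)$ be the number of circular sequences that are feasible from $S$, and let $\gamma^{\min}_{\rm sgp}(n)$ be the minimum of $\gamma(S)$ over all balanced bichromatic sets $S$ of $2n$ points in strong general position. Theorem. There are an absolute constant $c>0$ and an $n_0$ such that for every $n\ge n_0$ and every balanced bichromatic set $S$ of $2n$ points in strong general position, $$\gamma(S)\;\ge\; c\,\frac{2^{\sqrt n}}{n}.$$ Hence $\gamma^{\min}_{\rm sgp}(n)=\Omega\bigl(2^{\sqrt n}/n\bigr)$. -/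

import Mathlib

/-- The Euclidean plane, identified with the complex numbers. -/
abbrev Plane : Type := ℂ

/-- The two letters of the alphabet `{r, b}`. -/
inductive PointColor : Type
  | red
  | blue

/-- The ray `h(p, v) = {p + t v : t ≥ 0}` with apex `p` and direction `v`. -/
def rayFrom (p v : Plane) : Set Plane :=
  {x | ∃ t : ℝ, 0 ≤ t ∧ x = p + t • v}

/-- A set of points is in general position if no three distinct points of it are collinear. -/
def InGeneralPosition (X : Set Plane) : Prop :=
  ∀ p ∈ X, ∀ q ∈ X, ∀ r ∈ X, p ≠ q → p ≠ r → q ≠ r → ¬ Collinear ℝ ({p, q, r} : Set Plane)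

/-- Strong general position: general position, and no two different pairs of points
span parallel lines. -/
def InStrongGeneralPosition (X : Set Plane) : Prop :=
  InGeneralPosition X ∧
    ∀ p ∈ X, ∀ q ∈ X, ∀ p' ∈ X, ∀ q' ∈ X, p ≠ q → p' ≠ q' →
      ({p, q} : Set Plane) ≠ {p', q'} →
        ¬ (affineSpan ℝ ({p, q} : Set Plane)).Parallel (affineSpan ℝ ({p', q'} : Set Plane))

/-- A finite bichromatic point set `S = R ∪ B` in the plane. -/
structure BichromaticSet where
  red : Finset Plane
  blue : Finset Plane
  disjoint : Disjoint red blue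

namespace BichromaticSet

/-- All the points of the set, of both colors. -/
noncomputable def points (S : BichromaticSet) : Finset Plane := S.red ∪ S.blue

open Classical in
/-- The color of a point; only used for the points of the set. -/
noncomputable def color (S : BichromaticSet) (p : Plane) : PointColor :=
  if p ∈ S.red then PointColor.red else PointColor.blue

/-- The set is balanced with `2 n` points: `n` red ones and `n` blue ones. -/
def IsBalanced (S : BichromaticSet) (n : ℕ) : Prop :=
  S.red.card = n ∧ S.blue.card = n

/-- The direction field `v` describes a set of pairwise-disjoint rays from `S`:
the ray of the point `p` is `rayFrom p (v p)`. -/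
def IsDisjointRays (S : BichromaticSet) (v : Plane → Plane) : Prop :=
  (∀ p ∈ S.points, v p ≠ 0) ∧
    (S.points : Set Plane).PairwiseDisjoint (fun p => rayFrom p (v p))

/-- `C` is the circular sequence of colors that the rays `rayFrom p (v p)`, `p ∈ S`, induce at
infinity in clockwise order: for a circle that encloses `S`, the points of `S` are listed as
`σ 0, σ 1, …` in such a way that the rays of these points meet the circle at angles that strictly
decrease, within less than one full turn. A ray whose apex is inside a circle meets the circle in
exactly one point, so that the listing is determined up to a rotation. -/
def IsCircularSequence (S : BichromaticSet) (v : Plane → Plane) (C : Cycle PointColor) : Prop :=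
  ∃ (o : Plane) (ρ : ℝ) (σ : Fin S.points.card ≃ S.points) (θ : Fin S.points.card → ℝ),
    (S.points : Set Plane) ⊆ Metric.ball o ρ ∧
    StrictAnti θ ∧
    (∀ i j, θ i < θ j + 2 * Real.pi) ∧
    (∀ i, circleMap o ρ (θ i) ∈ rayFrom (σ i : Plane) (v (σ i : Plane))) ∧
    C = ((List.ofFn fun i => S.color (σ i : Plane)) : Cycle PointColor)

/-- The circular sequence `C` is feasible from `S`: it is induced by pairwise-disjoint rays. For
balanced `S` with `2 n` points it then has `n` red and `n` blue elements. -/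
def IsFeasible (S : BichromaticSet) (C : Cycle PointColor) : Prop :=
  ∃ v : Plane → Plane, S.IsDisjointRays v ∧ S.IsCircularSequence v C

/-- `γ(S)`, the number of configurations that are feasible from `S`. -/
noncomputable def gamma (S : BichromaticSet) : ℕ :=
  {C : Cycle PointColor | S.IsFeasible C}.ncard

end BichromaticSet

/-- `γ^min_sgp(n)`, the minimum of `γ(S)` over all balanced bichromatic sets `S` of `2 n` points in
strong general position. -/
noncomputable def gammaMinSgp (n : ℕ) : ℕ :=
  sInf {k : ℕ | ∃ S : BichromaticSet,
    S.IsBalanced n ∧ InStrongGeneralPosition (S.points : Set Plane) ∧ S.gamma = k}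

/-! A line with `n` points above it leaves, for one of the colors, at least `n / 2` points above it
and equally many points of the other color below. Among the segments joining two such classes, the
one that crosses the line leftmost has all the other points of the classes on the right of its
supporting line. Removing it and repeating gives bichromatic edges, each lying to the right of the
lines through all earlier ones (`exists_ordered_matching`). An Erdős–Szekeres argument
(`exists_records`) keeps `k` edges, `k (k + 1) ≥ n`, each of which leans further right, or further
left, than all kept predecessors. Its upward or downward direction, respectively, then points to the
right of every earlier edge. Each point of `S` joins the first kept edge whose line it is not
strictly right of (by default the last edge) and shoots its ray parallel to that edge. Later groups
start, and travel, to the right of the rays of earlier groups, so rays of different groups are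
disjoint. Inside a group strong general position makes the two ends of the edge the only collision.
Turning the whole group slightly one way or the other separates these two rays, and the sense of the
turn decides which color comes first at infinity, without moving any other ray in the order. The `k`
independent choices give `2 ^ k` distinct words (`BichromaticSet.two_pow_le_of_fan`). A circular
sequence has at most `2 * n` rotations, hence `2 ^ k ≤ 2 * n * γ(S)`. -/

open Filter Topology

/-! ### Plane vectors, and where rays meet a large circle -/

/-- The cross product of two plane vectors; positive if `b` points to the left of `a`. -/
def cross (a b : Plane) : ℝ := a.re * b.im - a.im * b.re

/-- The unit vector of angle `t`. -/
noncomputable def dir (t : ℝ) : Plane := ⟨Real.cos t, Real.sin t⟩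

theorem dir_ne_zero (t : ℝ) : dir t ≠ 0 := by
  intro h
  have h1 := congrArg Complex.re h
  have h2 := congrArg Complex.im h
  simp only [dir, Complex.zero_re, Complex.zero_im] at h1 h2
  have := Real.sin_sq_add_cos_sq t
  rw [h1, h2] at this
  norm_num at this

theorem cross_dir_self (t : ℝ) : cross (dir t) (dir t) = 0 := by
  simp only [cross, dir]; ring

theorem cross_smul_right (a b : Plane) (r : ℝ) : cross a (r • b) = r * cross a b := by
  simp only [cross, Complex.real_smul, Complex.re_ofReal_mul, Complex.im_ofReal_mul]; ring

theorem cross_smul_left (a b : Plane) (r : ℝ) : cross (r • a) b = r * cross a b := by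
  simp only [cross, Complex.real_smul, Complex.re_ofReal_mul, Complex.im_ofReal_mul]; ring

theorem cross_add_right (a b c : Plane) : cross a (b + c) = cross a b + cross a c := by
  simp only [cross, Complex.add_re, Complex.add_im]; ring

theorem cross_sub_right (a b c : Plane) : cross a (b - c) = cross a b - cross a c := by
  simp only [cross, Complex.sub_re, Complex.sub_im]; ring

theorem cross_dir_dir_add (t d : ℝ) : cross (dir (t + d)) (dir t) = -Real.sin d := by
  simp only [cross, dir, Real.cos_add, Real.sin_add]
  have := Real.sin_sq_add_cos_sq t
  linear_combination (-Real.sin d) * this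

theorem continuous_cross {f g : ℝ → Plane} (hf : Continuous f) (hg : Continuous g) :
    Continuous fun e => cross (f e) (g e) := by
  unfold cross
  exact ((Complex.continuous_re.comp hf).mul (Complex.continuous_im.comp hg)).sub
    ((Complex.continuous_im.comp hf).mul (Complex.continuous_re.comp hg))

theorem continuous_dir : Continuous dir := by
  have : dir = fun t => (Real.cos t : ℂ) + (Real.sin t : ℂ) * Complex.I := by
    funext t
    apply Complex.ext <;> simp [dir, -Complex.ofReal_cos, -Complex.ofReal_sin]
  rw [this]
  fun_prop

/-- The angle at which the ray from `x` of direction `dir a` meets the circle of radius `ρ`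
around the origin. -/
theorem circleMap_mem_rayFrom (x : Plane) (a ρ : ℝ) (hx : ‖x‖ < ρ) :
    circleMap 0 ρ (a + Real.arcsin (cross (dir a) x / ρ)) ∈ rayFrom x (dir a) := by
  have hρ : 0 < ρ := (norm_nonneg x).trans_lt hx
  set h := cross (dir a) x with hh
  set c := Real.cos a * x.re + Real.sin a * x.im with hc
  have hcs := Real.sin_sq_add_cos_sq a
  have hnorm : c ^ 2 + h ^ 2 = ‖x‖ ^ 2 := by
    rw [Complex.sq_norm, Complex.normSq_apply, hh, hc]
    simp only [cross, dir]
    linear_combination (x.re ^ 2 + x.im ^ 2) * hcs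
  have hlt : ‖x‖ ^ 2 < ρ ^ 2 := by
    have := norm_nonneg x
    nlinarith
  have hh1 : |h| < ρ := by
    apply abs_lt_of_sq_lt_sq _ hρ.le
    nlinarith [sq_nonneg c]
  obtain ⟨hl, hu⟩ := abs_lt.1 hh1
  have hs : Real.sin (Real.arcsin (h / ρ)) = h / ρ := by
    apply Real.sin_arcsin
    · rw [le_div_iff₀ hρ]; linarith
    · rw [div_le_iff₀ hρ]; linarith
  have hcos : ρ * Real.cos (Real.arcsin (h / ρ)) = √(ρ ^ 2 - h ^ 2) := by
    rw [Real.cos_arcsin]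
    have : ρ ^ 2 - h ^ 2 = ρ ^ 2 * (1 - (h / ρ) ^ 2) := by field_simp
    rw [this, Real.sqrt_mul (sq_nonneg ρ), Real.sqrt_sq hρ.le]
  -- The line of the ray has signed distance `h` from the origin; the exit point is half a chord
  -- past the foot of the perpendicular, and `x` is at position `c` relative to that foot.
  refine ⟨√(ρ ^ 2 - h ^ 2) - c, ?_, ?_⟩
  · rw [sub_nonneg]
    apply Real.le_sqrt_of_sq_le
    linarith
  · have hs' : ρ * Real.sin (Real.arcsin (h / ρ)) = h := by rw [hs]; field_simp
    set b := Real.arcsin (h / ρ)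
    rw [circleMap]
    apply Complex.ext
    · rw [← hcos]
      simp only [zero_add, Complex.re_ofReal_mul, Complex.exp_ofReal_mul_I_re, Complex.add_re,
        Complex.real_smul, dir, Real.cos_add]
      have : ρ * Real.sin b = Real.cos a * x.im - Real.sin a * x.re := by rw [hs']; rfl
      rw [hc]
      linear_combination (-Real.sin a) * this + x.re * hcs
    · rw [← hcos]
      simp only [zero_add, Complex.im_ofReal_mul, Complex.exp_ofReal_mul_I_im, Complex.add_im,
        Complex.real_smul, dir, Real.sin_add]
      have : ρ * Real.sin b = Real.cos a * x.im - Real.sin a * x.re := by rw [hs']; rfl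
      rw [hc]
      linear_combination (Real.cos a) * this + x.im * hcs

/-! ### Words of colors and circular sequences -/

theorem PointColor.finite : Finite PointColor :=
  Finite.of_surjective (fun b : Bool => if b then PointColor.red else PointColor.blue)
    (fun c => by cases c; exacts [⟨true, rfl⟩, ⟨false, rfl⟩])

theorem BichromaticSet.finite_feasible (S : BichromaticSet) :
    {C : Cycle PointColor | S.IsFeasible C}.Finite := by
  have := PointColor.finite
  refine ((List.finite_length_eq PointColor S.points.card).image
    (fun l : List PointColor => (l : Cycle PointColor))).subset ?_
  rintro C ⟨v, -, o, ρ, σ, θ, -, -, -, -, rfl⟩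
  exact ⟨_, by simp, rfl⟩

/-- Distinct feasible words give few coinciding circular sequences. -/
theorem BichromaticSet.card_le_mul_gamma (S : BichromaticSet) {ι : Type*} [Fintype ι]
    (hS : 0 < S.points.card)
    (w : ι → List PointColor) (hw : Function.Injective w)
    (hlen : ∀ s, (w s).length = S.points.card)
    (hf : ∀ s, S.IsFeasible (w s : Cycle PointColor)) :
    Fintype.card ι ≤ S.points.card * S.gamma := by
  classical
  have hfin := S.finite_feasible
  have hg : S.gamma = hfin.toFinset.card := Set.ncard_eq_toFinset_card _ hfin
  rw [hg, ← Finset.card_univ]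
  -- A fibre of the passage to cycles consists of rotations of one word, at most as many as it has
  -- letters.
  refine Finset.card_le_mul_card_image_of_maps_to (f := fun s => (w s : Cycle PointColor)) ?_ _ ?_
  · intro s _
    simpa using hf s
  · intro C hC
    induction C using Quotient.inductionOn with
    | _ l => ?_
    by_cases hl : l.length = S.points.card
    · rw [← Finset.card_image_of_injective _ hw]
      calc _ ≤ l.cyclicPermutations.toFinset.card := by
            apply Finset.card_le_card
            intro x hx
            simp only [Finset.mem_image, Finset.mem_filter, Finset.mem_univ, true_and] at hx
            obtain ⟨s, hs, rfl⟩ := hx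
            rw [List.mem_toFinset, List.mem_cyclicPermutations_iff]
            exact Quotient.exact hs
        _ ≤ l.cyclicPermutations.length := List.toFinset_card_le _
        _ = S.points.card := by
            rw [List.length_cyclicPermutations_of_ne_nil, hl]
            rintro rfl
            simp at hl
            omega
    · refine le_trans (le_of_eq (Finset.card_eq_zero.2
        (Finset.eq_empty_of_forall_notMem fun s hs => hl ?_))) (Nat.zero_le _)
      simp only [Finset.mem_filter, Finset.mem_univ, true_and] at hs
      rw [← hlen s]
      exact (Quotient.exact hs : List.IsRotated _ _).perm.length_eq.symm

theorem exists_equiv_strictAnti {β L : Type*} [Fintype β] [LinearOrder L] (K : β → L)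
    (hK : Function.Injective K) {m : ℕ} (hm : Fintype.card β = m) :
    ∃ σ : Fin m ≃ β, StrictAnti (K ∘ σ) := by
  let _ : LinearOrder β := LinearOrder.lift' (fun x => OrderDual.toDual (K x))
    (fun x y h => hK (OrderDual.toDual.injective h))
  let e := monoEquivOfFin β hm
  refine ⟨e.toEquiv, fun i j hij => ?_⟩
  have : e i < e j := e.strictMono hij
  exact this

theorem card_lt_of_strictAnti {β L : Type*} [Fintype β] [LinearOrder L] (K : β → L)
    {m : ℕ} (σ : Fin m ≃ β) (hσ : StrictAnti (K ∘ σ)) (i : Fin m) :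
    (Finset.univ.filter fun y => K (σ i) < K y).card = i := by
  classical
  rw [← Fin.card_Iio i, ← Finset.card_map σ.toEmbedding]
  congr 1
  ext y
  obtain ⟨j, rfl⟩ := σ.surjective y
  simp only [Finset.mem_filter, Finset.mem_univ, true_and, Finset.mem_map_equiv,
    Equiv.symm_apply_apply, Finset.mem_Iio]
  exact hσ.lt_iff_gt

/-- The order in which the ray from `x` of direction `dir (α x)` is met at infinity, when
running counterclockwise. -/
noncomputable def rayKey (α : Plane → ℝ) (x : Plane) : ℝ ×ₗ ℝ :=
  toLex (α x, cross (dir (α x)) x)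

theorem tendsto_arcsin_div (c : ℝ) :
    Tendsto (fun ρ : ℝ => Real.arcsin (c / ρ)) atTop (𝓝 0) := by
  have h1 : Tendsto (fun ρ : ℝ => c / ρ) atTop (𝓝 0) := tendsto_const_nhds.div_atTop tendsto_id
  have := (Real.continuous_arcsin.tendsto 0).comp h1
  rwa [Real.arcsin_zero] at this

/-- On a circle of radius `ρ` the ray from `x` exits at angle `α x + arcsin (h / ρ)` with `h` the
second component of its key, so for large `ρ` the exit angles are ordered like the keys. Cutting the
circle opposite to `φ` turns the circular sequence into a word, in which the position of `x` is the
number of larger keys. -/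
theorem BichromaticSet.exists_word (S : BichromaticSet) (α : Plane → ℝ) (φ : ℝ)
    (hα : ∀ x ∈ S.points, |α x - φ| < Real.pi)
    (hd : S.IsDisjointRays fun x => dir (α x))
    (hinj : Set.InjOn (rayKey α) S.points) :
    ∃ w : List PointColor, w.length = S.points.card ∧ S.IsFeasible (w : Cycle PointColor) ∧
      ∀ x ∈ S.points,
        w[(S.points.filter fun y => rayKey α x < rayKey α y).card]? = some (S.color x) := by
  classical
  obtain ⟨σ, hσ⟩ := exists_equiv_strictAnti (fun x : S.points => rayKey α x)
    (fun x y h => Subtype.ext (hinj x.2 y.2 h)) (m := S.points.card) (by simp)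
  have hev : ∀ᶠ ρ : ℝ in atTop, ∀ x ∈ S.points, ∀ y ∈ S.points,
      ‖x‖ < ρ ∧ |α x + Real.arcsin (cross (dir (α x)) x / ρ) - φ| < Real.pi ∧
      (rayKey α x < rayKey α y → α x + Real.arcsin (cross (dir (α x)) x / ρ) <
        α y + Real.arcsin (cross (dir (α y)) y / ρ)) := by
    rw [eventually_all_finset]
    intro x hx
    rw [eventually_all_finset]
    intro y hy
    refine (eventually_gt_atTop _).and (.and ?_ ?_)
    · have : Tendsto (fun ρ : ℝ => |α x + Real.arcsin (cross (dir (α x)) x / ρ) - φ|) atTop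
          (𝓝 |α x + 0 - φ|) :=
        ((tendsto_const_nhds.add (tendsto_arcsin_div _)).sub tendsto_const_nhds).abs
      rw [add_zero] at this
      exact this.eventually_lt_const (hα x hx)
    · by_cases hk : rayKey α x < rayKey α y
      · rcases Prod.Lex.toLex_lt_toLex.1 hk with h | ⟨h, h'⟩
        · have hx' : Tendsto (fun ρ : ℝ => α x + Real.arcsin (cross (dir (α x)) x / ρ)) atTop
              (𝓝 (α x + 0)) := tendsto_const_nhds.add (tendsto_arcsin_div _)
          have hy' : Tendsto (fun ρ : ℝ => α y + Real.arcsin (cross (dir (α y)) y / ρ)) atTop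
              (𝓝 (α y + 0)) := tendsto_const_nhds.add (tendsto_arcsin_div _)
          filter_upwards [hx'.eventually_lt hy' (by simpa using h)] with ρ hρ _ using hρ
        · have hx' : Tendsto (fun ρ : ℝ => cross (dir (α x)) x / ρ) atTop (𝓝 0) :=
            tendsto_const_nhds.div_atTop tendsto_id
          have hy' : Tendsto (fun ρ : ℝ => cross (dir (α y)) y / ρ) atTop (𝓝 0) :=
            tendsto_const_nhds.div_atTop tendsto_id
          filter_upwards [eventually_gt_atTop 0,
            hx'.eventually (Icc_mem_nhds (a := (-1 : ℝ)) (b := 1) (by norm_num) (by norm_num)),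
            hy'.eventually (Icc_mem_nhds (a := (-1 : ℝ)) (b := 1) (by norm_num) (by norm_num))]
            with ρ h0 h1 h2 _
          simp only at h h'
          rw [h]
          gcongr ?_ + ?_
          apply Real.strictMonoOn_arcsin (by rwa [h] at h1) h2
          rw [h] at h'
          gcongr
      · exact Eventually.of_forall fun _ h => absurd h hk
  obtain ⟨ρ, hρ⟩ := hev.exists
  refine ⟨List.ofFn fun i => S.color (σ i : Plane), by simp, ⟨_, hd, 0, ρ, σ, fun i =>
    α (σ i) + Real.arcsin (cross (dir (α (σ i))) (σ i) / ρ), ?_, ?_, ?_, ?_, rfl⟩, ?_⟩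
  · intro x hx
    simpa using (hρ x hx x hx).1
  · intro i j hij
    exact (hρ _ (σ j).2 _ (σ i).2).2.2 (hσ hij)
  · intro i j
    have hi := (abs_lt.1 (hρ _ (σ i).2 _ (σ i).2).2.1).2
    have hj := (abs_lt.1 (hρ _ (σ j).2 _ (σ j).2).2.1).1
    linarith
  · intro i
    exact circleMap_mem_rayFrom _ _ _ (hρ _ (σ i).2 _ (σ i).2).1
  · intro x hx
    obtain ⟨i, hi⟩ := σ.surjective ⟨x, hx⟩
    have hcard := card_lt_of_strictAnti (fun x : S.points => rayKey α x) σ hσ i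
    have : (S.points.filter fun y => rayKey α x < rayKey α y).card = i := by
      rw [← hcard, ← Finset.card_map (Function.Embedding.subtype _)]
      congr 1
      ext y
      simp [hi]
      tauto
    rw [this]
    simp [hi]

/-! ### Fans: groups of parallel rays and their perturbations -/

section fan

variable {S : BichromaticSet} {k : ℕ} {g : Plane → Fin k} {φ : ℝ} {α t : Fin k → ℝ}
  {p q : Fin k → Plane}

/-- The angles `α` can be perturbed so that the rays of `p i` and `q i` are swapped as prescribed,
and nothing else changes. -/
theorem exists_perturbation (T : Finset Plane) (s : Fin k → Bool)
    (hα : ∀ i, |α i - φ| < Real.pi)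
    (ha : ∀ x ∈ T, ∀ y ∈ T, g x < g y → 0 < t (g x) * cross (dir (α (g x))) (y - x))
    (hb : ∀ i j, i < j → 0 < t i * cross (dir (α i)) (dir (α j)))
    (hpq : ∀ i, ∃ r : ℝ, 0 < r ∧ q i - p i = r • dir (α i)) :
    ∃ A : Fin k → ℝ, (∀ i, |A i - φ| < Real.pi) ∧
      (∀ x ∈ T, ∀ y ∈ T, g x < g y → 0 < t (g x) * cross (dir (A (g x))) (y - x)) ∧
      (∀ i j, i < j → 0 < t i * cross (dir (A i)) (dir (A j))) ∧
      (∀ i j, α i < α j → A i < A j) ∧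
      (∀ i, ∀ x ∈ T, ∀ y ∈ T, cross (dir (α i)) x < cross (dir (α i)) y →
        cross (dir (A i)) x < cross (dir (A i)) y) ∧
      (∀ i, if s i then cross (dir (A i)) (q i) < cross (dir (A i)) (p i)
        else cross (dir (A i)) (p i) < cross (dir (A i)) (q i)) := by
  -- All requirements but the last are finitely many strict inequalities valid at `e = 0`, so they
  -- persist for small `e > 0`. The last one follows from the sense of the rotation, as `q i - p i`
  -- points along the unperturbed ray.
  let A : ℝ → Fin k → ℝ := fun e i => α i + if s i then e else -e
  have hA : ∀ i, Continuous fun e => A e i := by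
    intro i
    cases hs : s i <;> simp only [A, hs, if_true, Bool.false_eq_true, if_false] <;> fun_prop
  have hA0 : ∀ i, A 0 i = α i := by intro i; simp [A]
  have hdir : ∀ i, Continuous fun e => dir (A e i) := fun i => continuous_dir.comp (hA i)
  have key : ∀ F G : ℝ → ℝ, Continuous F → Continuous G → F 0 < G 0 →
      ∀ᶠ e in 𝓝[>] (0 : ℝ), F e < G e := fun F G hF hG h =>
    ((hF.tendsto 0).eventually_lt (hG.tendsto 0) h).filter_mono nhdsWithin_le_nhds
  have hev : ∀ᶠ e in 𝓝[>] (0 : ℝ), (∀ i, |A e i - φ| < Real.pi) ∧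
      (∀ x ∈ T, ∀ y ∈ T, g x < g y → 0 < t (g x) * cross (dir (A e (g x))) (y - x)) ∧
      (∀ i j, i < j → 0 < t i * cross (dir (A e i)) (dir (A e j))) ∧
      (∀ i j, α i < α j → A e i < A e j) ∧
      (∀ i, ∀ x ∈ T, ∀ y ∈ T, cross (dir (α i)) x < cross (dir (α i)) y →
        cross (dir (A e i)) x < cross (dir (A e i)) y) ∧ (0 < e ∧ e < Real.pi) := by
    simp only [eventually_and, eventually_all, eventually_all_finset]
    refine ⟨?_, ?_, ?_, ?_, ?_, self_mem_nhdsWithin, ?_⟩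
    · intro i
      exact key _ _ (((hA i).sub continuous_const).abs) continuous_const (by rw [hA0]; exact hα i)
    · intro x hx y hy hxy
      exact key _ _ continuous_const
        (continuous_const.mul (continuous_cross (hdir _) continuous_const))
        (by rw [hA0]; exact ha x hx y hy hxy)
    · intro i j hij
      exact key _ _ continuous_const
        (continuous_const.mul (continuous_cross (hdir _) (hdir _)))
        (by rw [hA0, hA0]; exact hb i j hij)
    · intro i j hij
      exact key _ _ (hA i) (hA j) (by rwa [hA0, hA0])
    · intro i x _ y _ hxy
      exact key _ _ (continuous_cross (hdir _) continuous_const)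
        (continuous_cross (hdir _) continuous_const) (by rwa [hA0])
    · exact key _ _ continuous_id continuous_const Real.pi_pos
  obtain ⟨e, h1, h2, h3, h4, h5, h6, h7⟩ := hev.exists
  refine ⟨A e, h1, h2, h3, h4, h5, fun i => ?_⟩
  obtain ⟨r, hr, hpq⟩ := hpq i
  have hsin := Real.sin_pos_of_pos_of_lt_pi h6 h7
  have : cross (dir (A e i)) (q i) - cross (dir (A e i)) (p i) =
      r * -Real.sin (if s i then e else -e) := by
    rw [← cross_sub_right, hpq, cross_smul_right, cross_dir_dir_add]
  by_cases hs : s i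
  · simp only [hs, if_true] at this ⊢
    nlinarith
  · simp only [hs, Bool.false_eq_true, if_false, Real.sin_neg, neg_neg] at this ⊢
    nlinarith [mul_pos hr hsin]

/-- The line of an earlier ray has the apex of a later ray strictly on one side, the side given by
the sign of `t`, and the later direction points into that side. Within a group the rays lie on
distinct parallel lines. -/
theorem isDisjointRays_of_fan {A : Fin k → ℝ}
    (ha : ∀ x ∈ S.points, ∀ y ∈ S.points, g x < g y →
      0 < t (g x) * cross (dir (A (g x))) (y - x))
    (hb : ∀ i j, i < j → 0 < t i * cross (dir (A i)) (dir (A j)))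
    (hc : ∀ x ∈ S.points, ∀ y ∈ S.points, x ≠ y → g x = g y →
      cross (dir (A (g x))) x ≠ cross (dir (A (g x))) y) :
    S.IsDisjointRays fun x => dir (A (g x)) := by
  refine ⟨fun x _ => dir_ne_zero _, ?_⟩
  have main : ∀ x ∈ S.points, ∀ y ∈ S.points, g x < g y → ∀ z,
      z ∈ rayFrom x (dir (A (g x))) → z ∈ rayFrom y (dir (A (g y))) → False := by
    rintro x hx y hy hxy z ⟨a, ha', rfl⟩ ⟨b, hb', h⟩
    have h1 := ha x hx y hy hxy
    have h2 := hb _ _ hxy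
    have h3 := congrArg (cross (dir (A (g x)))) h
    rw [cross_add_right, cross_add_right, cross_smul_right, cross_smul_right,
      cross_dir_self] at h3
    rw [cross_sub_right] at h1
    have h4 : cross (dir (A (g x))) y - cross (dir (A (g x))) x =
        -(b * cross (dir (A (g x))) (dir (A (g y)))) := by linarith
    rw [h4] at h1
    nlinarith [mul_nonneg hb' h2.le]
  intro x hx y hy hxy
  refine Set.disjoint_left.2 fun z hzx hzy => ?_
  rcases lt_trichotomy (g x) (g y) with h | h | h
  · exact main x hx y hy h z hzx hzy
  · obtain ⟨a, -, rfl⟩ := hzx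
    obtain ⟨b, -, hz⟩ := hzy
    apply hc x hx y hy hxy h
    simp only [← h] at hz
    have h3 := congrArg (cross (dir (A (g x)))) hz
    simpa only [cross_add_right, cross_smul_right, cross_dir_self, mul_zero, add_zero] using h3
  · exact main y hy x hx h z hzy hzx

/-- A family of points divided into groups with parallel rays, such that each group contains a
bichromatic pair in the direction of its rays, yields `2 ^ k` words. -/
theorem BichromaticSet.two_pow_le_of_fan
    (hp : ∀ i, p i ∈ S.points) (hq : ∀ i, q i ∈ S.points)
    (hgp : ∀ i, g (p i) = i) (hgq : ∀ i, g (q i) = i)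
    (hcol : ∀ i, S.color (p i) ≠ S.color (q i)) (hS : 0 < S.points.card)
    (hα : ∀ i, |α i - φ| < Real.pi)
    (ha : ∀ x ∈ S.points, ∀ y ∈ S.points, g x < g y →
      0 < t (g x) * cross (dir (α (g x))) (y - x))
    (hb : ∀ i j, i < j → 0 < t i * cross (dir (α i)) (dir (α j)))
    (hc : ∀ x ∈ S.points, ∀ y ∈ S.points, x ≠ y → g x = g y →
      cross (dir (α (g x))) x = cross (dir (α (g x))) y →
        (x = p (g x) ∨ x = q (g x)) ∧ (y = p (g x) ∨ y = q (g x)))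
    (hpq : ∀ i, ∃ r : ℝ, 0 < r ∧ q i - p i = r • dir (α i)) :
    2 ^ k ≤ S.points.card * S.gamma := by
  classical
  have hαinj : Function.Injective α := by
    intro i j hij
    by_contra hne
    rcases lt_or_gt_of_ne hne with h | h
    · have := hb _ _ h; rw [hij, cross_dir_self] at this; simp at this
    · have := hb _ _ h; rw [hij, cross_dir_self] at this; simp at this
  have hpq0 : ∀ i, cross (dir (α i)) (p i) = cross (dir (α i)) (q i) := by
    intro i
    obtain ⟨r, -, h⟩ := hpq i
    have := congrArg (cross (dir (α i))) h
    rw [cross_sub_right, cross_smul_right, cross_dir_self] at this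
    linarith
  -- The number of rays that precede both ends of edge `i`. It does not depend on the choices `s`,
  -- so the letter at position `N i` reveals `s i`.
  let N : Fin k → ℕ := fun i => (S.points.filter fun y => y ≠ p i ∧ y ≠ q i ∧
    (α i < α (g y) ∨ g y = i ∧ cross (dir (α i)) (p i) < cross (dir (α i)) y)).card
  have hw : ∀ s : Fin k → Bool, ∃ w : List PointColor, w.length = S.points.card ∧
      S.IsFeasible (w : Cycle PointColor) ∧
      ∀ i, w[N i]? = some (if s i then S.color (p i) else S.color (q i)) := by
    intro s
    obtain ⟨A, h1, h2, h3, h4, h5, h6⟩ := exists_perturbation S.points s hα ha hb hpq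
    have h4' : ∀ i j, A i < A j → α i < α j := by
      intro i j h
      rcases lt_trichotomy (α i) (α j) with h' | h' | h'
      · exact h'
      · rw [hαinj h'] at h; exact absurd h (lt_irrefl _)
      · exact absurd (h4 _ _ h') h.not_gt
    have hAinj : Function.Injective A := by
      intro i j h
      rcases lt_trichotomy (α i) (α j) with h' | h' | h'
      · exact absurd (h4 _ _ h') h.not_lt
      · exact hαinj h'
      · exact absurd (h4 _ _ h') h.not_gt
    have h6' : ∀ i, cross (dir (A i)) (p i) ≠ cross (dir (A i)) (q i) := by
      intro i
      have := h6 i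
      split_ifs at this
      · exact this.ne'
      · exact this.ne
    have hcA : ∀ x ∈ S.points, ∀ y ∈ S.points, x ≠ y → g x = g y →
        cross (dir (A (g x))) x ≠ cross (dir (A (g x))) y := by
      intro x hx y hy hxy hg
      rcases lt_trichotomy (cross (dir (α (g x))) x) (cross (dir (α (g x))) y) with h | h | h
      · exact (h5 _ x hx y hy h).ne
      · obtain ⟨hx' | hx', hy' | hy'⟩ := hc x hx y hy hxy hg h
        · exact absurd (hx'.trans hy'.symm) hxy
        · have := h6' (g x); rwa [← hx', ← hy'] at this
        · have := (h6' (g x)).symm; rwa [← hx', ← hy'] at this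
        · exact absurd (hx'.trans hy'.symm) hxy
      · exact (h5 _ y hy x hx h).ne'
    obtain ⟨w, hlen, hf, hwc⟩ := S.exists_word (fun x => A (g x)) φ (fun x _ => h1 _)
      (isDisjointRays_of_fan h2 h3 hcA) (by
        intro x hx y hy hxy
        by_contra hne
        have hxy' := Prod.ext_iff.1 (toLex.injective hxy)
        have hg := hAinj hxy'.1
        exact hcA x hx y hy hne hg (by simpa [← hg] using hxy'.2))
    refine ⟨w, hlen, hf, fun i => ?_⟩
    -- Here `z` is the end of edge `i` met first, and `z'` is the other end.
    have count : ∀ z z', z ∈ S.points → g z = i →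
        (z = p i ∧ z' = q i ∨ z = q i ∧ z' = p i) →
        cross (dir (A i)) z' < cross (dir (A i)) z → w[N i]? = some (S.color z) := by
      intro z z' hz hgz hzz hlt
      rw [← hwc z hz]
      congr 2
      refine congrArg Finset.card (Finset.filter_congr ?_)
      intro y hy
      have hz0 : cross (dir (α i)) z = cross (dir (α i)) (p i) := by
        rcases hzz with ⟨rfl, -⟩ | ⟨rfl, -⟩
        · rfl
        · exact (hpq0 i).symm
      have hyz : (y ≠ p i ∧ y ≠ q i) ↔ (y ≠ z ∧ y ≠ z') := by
        rcases hzz with ⟨rfl, rfl⟩ | ⟨rfl, rfl⟩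
        · rfl
        · exact and_comm
      rw [← and_assoc, hyz, ← hz0, rayKey, rayKey, Prod.Lex.toLex_lt_toLex]
      simp only [hgz]
      constructor
      · rintro ⟨⟨hy1, hy2⟩, h | ⟨h, h'⟩⟩
        · exact Or.inl (h4 _ _ h)
        · rw [h]
          exact Or.inr ⟨rfl, h5 _ z hz y hy h'⟩
      · rintro (h | ⟨h, h'⟩)
        · refine ⟨⟨?_, ?_⟩, Or.inl (h4' _ _ h)⟩
          · rintro rfl
            rw [hgz] at h
            exact lt_irrefl _ h
          · rintro rfl
            have : g y = i := by
              rcases hzz with ⟨-, rfl⟩ | ⟨-, rfl⟩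
              · exact hgq i
              · exact hgp i
            rw [this] at h
            exact lt_irrefl _ h
        · have hg := hAinj h
          rw [← hg] at h'
          have hne : y ≠ z := by rintro rfl; exact lt_irrefl _ h'
          have hne' : y ≠ z' := by rintro rfl; exact lt_asymm h' hlt
          refine ⟨⟨hne, hne'⟩, Or.inr ⟨hg.symm, ?_⟩⟩
          rcases lt_trichotomy (cross (dir (α i)) z) (cross (dir (α i)) y) with h8 | h8 | h8
          · exact h8
          · have h9 := hc z hz y hy hne.symm (hgz.trans hg) (by rwa [hgz])
            rw [hgz] at h9
            have := hyz.2 ⟨hne, hne'⟩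
            exact absurd h9.2 (not_or.2 this)
          · exact absurd (h5 _ y hy z hz h8) h'.not_gt
    have := h6 i
    split_ifs at this with hs
    · simpa [hs] using count (p i) (q i) (hp i) (hgp i) (Or.inl ⟨rfl, rfl⟩) this
    · simpa [hs] using count (q i) (p i) (hq i) (hgq i) (Or.inr ⟨rfl, rfl⟩) this
  choose w hlen hf hN using hw
  have := S.card_le_mul_gamma hS w (by
    intro s s' h
    funext i
    have h1 := hN s i
    rw [h, hN s' i] at h1
    have h2 := Option.some.inj h1
    have h3 := hcol i
    cases h4 : s i <;> cases h5 : s' i <;> simp [h4, h5] at h2 ⊢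
    · exact h3 h2
    · exact h3 h2.symm) hlen hf
  simpa using this

end fan

/-! ### Monotone chains and records -/

/-- `U v` is a longest increasing subsequence starting at `v`; if `w` is later and higher, `v` can
be put in front of `U w`. -/
theorem exists_increasing_chains {N : ℕ} (s : Fin N → ℝ) :
    ∃ U : Fin N → Finset (Fin N), (∀ v, v ∈ U v) ∧ (∀ v, ∀ x ∈ U v, v ≤ x) ∧
      (∀ v, StrictMonoOn s (U v)) ∧ ∀ v w, v < w → s v < s w → (U w).card < (U v).card := by
  classical
  let F : Fin N → Finset (Finset (Fin N)) := fun v =>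
    Finset.univ.filter fun U => v ∈ U ∧ (∀ x ∈ U, v ≤ x) ∧ StrictMonoOn s (U : Set (Fin N))
  have hF : ∀ v, (F v).Nonempty := fun v => ⟨{v}, by simp [F]⟩
  have h := fun v => (F v).exists_max_image Finset.card (hF v)
  choose U hU hmax using h
  simp only [F, Finset.mem_filter, Finset.mem_univ, true_and] at hU hmax
  refine ⟨U, fun v => (hU v).1, fun v => (hU v).2.1, fun v => (hU v).2.2, fun v w hvw hs => ?_⟩
  have hv : v ∉ U w := fun h => ((hU w).2.1 v h).not_gt hvw
  have := hmax v (insert v (U w)) ⟨Finset.mem_insert_self _ _, ?_, ?_⟩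
  · rw [Finset.card_insert_of_notMem hv] at this
    exact this
  · intro x hx
    rcases Finset.mem_insert.1 hx with rfl | hx
    · exact le_rfl
    · exact hvw.le.trans ((hU w).2.1 x hx)
  · intro x hx y hy hxy
    rw [Finset.coe_insert] at hx hy
    have hwy : ∀ z ∈ U w, s v < s z := fun z hz =>
      hs.trans_le ((hU w).2.2.monotoneOn (hU w).1 hz ((hU w).2.1 z hz))
    rcases hx with rfl | hx <;> rcases hy with rfl | hy
    · exact absurd hxy (lt_irrefl _)
    · exact hwy y hy
    · exact absurd (((hU w).2.1 x hx).trans_lt hxy) hvw.not_gt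
    · exact (hU w).2.2 hx hy hxy

/-- In a sequence of `N` distinct reals there is a subsequence of length `k`, where
`2 N ≤ k (k + 1)`, every term of which is a strict record from above or from below. -/
theorem exists_records {N : ℕ} (s : Fin N → ℝ) (hs : Function.Injective s) :
    ∃ K : Finset (Fin N), 2 * N ≤ K.card * (K.card + 1) ∧
      ∀ j ∈ K, (∀ i ∈ K, i < j → s i < s j) ∨ (∀ i ∈ K, i < j → s j < s i) := by
  classical
  obtain ⟨U, hU1, hU2, hU3, hU4⟩ := exists_increasing_chains s
  obtain ⟨D, hD1, hD2, hD3, hD4⟩ := exists_increasing_chains fun i => -s i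
  rcases Nat.eq_zero_or_pos N with rfl | hN
  · exact ⟨∅, by simp⟩
  have : Nonempty (Fin N) := ⟨⟨0, hN⟩⟩
  -- The longest increasing and the longest decreasing chain from a common start `v` share only `v`.
  -- After `v`, the first stays above `s v` and the second below, so every term of the union is a
  -- record.
  obtain ⟨v, -, hv⟩ := Finset.univ.exists_max_image
    (fun v => (U v).card + (D v).card) Finset.univ_nonempty
  have hUD : U v ∩ D v = {v} := by
    ext x
    simp only [Finset.mem_inter, Finset.mem_singleton]
    constructor
    · rintro ⟨h1, h2⟩
      by_contra hne
      have hlt := lt_of_le_of_ne (hU2 v x h1) (Ne.symm hne)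
      have h3 := hU3 v (hU1 v) h1 hlt
      have h4 := hD3 v (hD1 v) h2 hlt
      simp only at h4
      linarith
    · rintro rfl
      exact ⟨hU1 _, hD1 _⟩
  have hcard : (U v ∪ D v).card + 1 = (U v).card + (D v).card := by
    rw [← Finset.card_union_add_card_inter, hUD, Finset.card_singleton]
  refine ⟨U v ∪ D v, ?_, ?_⟩
  · set k := (U v ∪ D v).card with hk
    -- The pairs of chain lengths are distinct, have positive entries and, by maximality at `v`, sum
    -- at most `k + 1`. Shifted to start at zero, they inject into this triangle.
    let T : Finset (Σ _ : ℕ, ℕ) := (Finset.range k).sigma fun m => Finset.range (m + 1)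
    have hT : 2 * T.card = k * (k + 1) := by
      rw [Finset.card_sigma]
      simp only [Finset.card_range]
      clear_value k
      clear hk hcard T
      induction k with
      | zero => simp
      | succ k ih => rw [Finset.sum_range_succ, mul_add, ih]; ring
    rw [← hT]
    apply Nat.mul_le_mul_left
    have hpos : ∀ w, 0 < (U w).card ∧ 0 < (D w).card := fun w =>
      ⟨Finset.card_pos.2 ⟨w, hU1 w⟩, Finset.card_pos.2 ⟨w, hD1 w⟩⟩
    calc N = (Finset.univ : Finset (Fin N)).card := by simp
      _ ≤ T.card := by
        apply Finset.card_le_card_of_injOn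
          (fun w => ⟨(U w).card + (D w).card - 2, (U w).card - 1⟩)
        · intro w _
          have h1 := hpos w
          have h2 := hv w (Finset.mem_univ _)
          simp only [T, Finset.coe_sigma, Set.mem_sigma_iff, Finset.mem_coe, Finset.mem_range]
          omega
        · have key : ∀ x y : Fin N, x < y → ¬ ((U x).card + (D x).card - 2 =
              (U y).card + (D y).card - 2 ∧ (U x).card - 1 = (U y).card - 1) := by
            intro x y hxy h
            have h1 := hpos x
            have h2 := hpos y
            rcases lt_or_gt_of_ne (hs.ne hxy.ne) with h' | h'
            · have := hU4 x y hxy h'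
              omega
            · have := hD4 x y hxy (by simpa using h')
              omega
          intro x _ y _ hxy
          have hxy' : (U x).card + (D x).card - 2 =
              (U y).card + (D y).card - 2 ∧ (U x).card - 1 = (U y).card - 1 := by
            simpa using hxy
          rcases lt_trichotomy x y with h | h | h
          · exact absurd hxy' (key x y h)
          · exact h
          · exact absurd ⟨hxy'.1.symm, hxy'.2.symm⟩ (key y x h)
  · intro j hj
    rcases Finset.mem_union.1 hj with hj | hj
    · left
      intro i hi hij
      rcases Finset.mem_union.1 hi with hi | hi
      · exact hU3 v hi hj hij
      · have h1 : s i ≤ s v := by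
          have := (hD3 v).monotoneOn (hD1 v) hi (hD2 v i hi)
          simpa using this
        exact h1.trans_lt (hU3 v (hU1 v) hj ((hD2 v i hi).trans_lt hij))
    · right
      intro i hi hij
      rcases Finset.mem_union.1 hi with hi | hi
      · have h1 : s v ≤ s i := (hU3 v).monotoneOn (hU1 v) hi (hU2 v i hi)
        have h2 := hD3 v (hD1 v) hj ((hU2 v i hi).trans_lt hij)
        simp only at h2
        linarith
      · have h2 := hD3 v hi hj hij
        simpa using h2

/-! ### Matchings across a line -/

/-- Coordinates of a point in the frame whose first axis has slope `t`. -/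
def frameX (t : ℝ) (x : Plane) : ℝ := x.re + t * x.im

/-- Coordinates of a point in the frame whose first axis has slope `t`. -/
def frameY (t : ℝ) (x : Plane) : ℝ := x.im - t * x.re

/-- The frame coordinates are a rotation scaled by `√(1 + t ^ 2)`, so orientations may be read off
in them. -/
theorem frame_cross (t : ℝ) (a b : Plane) :
    (1 + t ^ 2) * cross a b = frameX t a * frameY t b - frameY t a * frameX t b := by
  simp only [cross, frameX, frameY]; ring

theorem frameX_sub (t : ℝ) (a b : Plane) : frameX t (a - b) = frameX t a - frameX t b := by
  simp only [frameX, Complex.sub_re, Complex.sub_im]; ring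

theorem frameY_sub (t : ℝ) (a b : Plane) : frameY t (a - b) = frameY t a - frameY t b := by
  simp only [frameY, Complex.sub_re, Complex.sub_im]; ring

/-- If the segment from `b` to `r` meets a line leftmost, all other points are right of it. -/
theorem exists_leftmost_pair (t c : ℝ) (A B : Finset Plane) (hA : ∀ x ∈ A, c < frameY t x)
    (hB : ∀ x ∈ B, frameY t x < c) (hAn : A.Nonempty) (hBn : B.Nonempty) :
    ∃ r ∈ A, ∃ b ∈ B, (∀ x ∈ A, cross (r - b) (x - b) ≤ 0) ∧
      ∀ x ∈ B, cross (r - b) (x - b) ≤ 0 := by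
  -- The first frame coordinate of the point where the segment crosses the level `c`. Replacing one
  -- end of the minimizing segment cannot move this crossing to the left.
  let P : Plane × Plane → ℝ := fun z =>
    ((frameY t z.1 - c) * frameX t z.2 - (frameY t z.2 - c) * frameX t z.1) /
      (frameY t z.1 - frameY t z.2)
  obtain ⟨⟨r, b⟩, hrb, hmin⟩ := (A ×ˢ B).exists_min_image P (hAn.product hBn)
  obtain ⟨hr, hb⟩ := Finset.mem_product.1 hrb
  have hrY := hA r hr
  have hbY := hB b hb
  have ht : 0 < 1 + t ^ 2 := by positivity
  refine ⟨r, hr, b, hb, fun x hx => ?_, fun x hx => ?_⟩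
  · have h := hmin (x, b) (Finset.mem_product.2 ⟨hx, hb⟩)
    have hxY := hA x hx
    simp only [P] at h
    rw [div_le_div_iff₀ (by linarith) (by linarith)] at h
    have hc := frame_cross t (r - b) (x - b)
    simp only [frameX_sub, frameY_sub] at hc
    by_contra hpos
    rw [not_le] at hpos
    have h1 := mul_pos (sub_pos.2 hbY) (mul_pos ht hpos)
    rw [hc] at h1
    linarith
  · have h := hmin (r, x) (Finset.mem_product.2 ⟨hr, hx⟩)
    have hxY := hB x hx
    simp only [P] at h
    rw [div_le_div_iff₀ (by linarith) (by linarith)] at h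
    have hc := frame_cross t (r - b) (x - b)
    simp only [frameX_sub, frameY_sub] at hc
    by_contra hpos
    rw [not_le] at hpos
    have h1 := mul_pos (sub_pos.2 hrY) (mul_pos ht hpos)
    rw [hc] at h1
    linarith

/-- Two equally large sets on different sides of a line have a matching, the edges of which are
ordered in such a way that each lies to the right of the lines through the preceding ones. -/
theorem exists_ordered_matching (t c : ℝ) (N : ℕ) : ∀ (A B : Finset Plane), A.card = N →
    B.card = N → (∀ x ∈ A, c < frameY t x) → (∀ x ∈ B, frameY t x < c) →
    (∀ x ∈ A ∪ B, ∀ y ∈ A ∪ B, ∀ z ∈ A ∪ B, x ≠ y → x ≠ z → y ≠ z →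
      cross (y - x) (z - x) ≠ 0) →
    ∃ r b : Fin N → Plane, (∀ i, r i ∈ A) ∧ (∀ i, b i ∈ B) ∧ ∀ i j, i < j →
      cross (r i - b i) (r j - b i) < 0 ∧ cross (r i - b i) (b j - b i) < 0 := by
  induction N with
  | zero => exact fun A B _ _ _ _ _ => ⟨Fin.elim0, Fin.elim0, fun i => i.elim0, fun i => i.elim0,
      fun i => i.elim0⟩
  | succ N ih =>
    intro A B hAc hBc hA hB hgp
    obtain ⟨r, hr, b, hb, h1, h2⟩ := exists_leftmost_pair t c A B hA hB
      (Finset.card_pos.1 (by omega)) (Finset.card_pos.1 (by omega))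
    have hsub : A.erase r ∪ B.erase b ⊆ A ∪ B :=
      Finset.union_subset_union (Finset.erase_subset _ _) (Finset.erase_subset _ _)
    obtain ⟨r', b', hr', hb', h'⟩ := ih (A.erase r) (B.erase b)
      (by rw [Finset.card_erase_of_mem hr, hAc]; rfl)
      (by rw [Finset.card_erase_of_mem hb, hBc]; rfl)
      (fun x hx => hA x (Finset.mem_of_mem_erase hx))
      (fun x hx => hB x (Finset.mem_of_mem_erase hx))
      (fun x hx y hy z hz => hgp x (hsub hx) y (hsub hy) z (hsub hz))
    have hAB : ∀ x ∈ A, ∀ y ∈ B, x ≠ y := by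
      rintro x hx y hy rfl
      exact lt_asymm (hA x hx) (hB x hy)
    have hrA : ∀ i, r' i ∈ A ∧ r' i ≠ r := fun i =>
      ⟨Finset.mem_of_mem_erase (hr' i), Finset.ne_of_mem_erase (hr' i)⟩
    have hbB : ∀ i, b' i ∈ B ∧ b' i ≠ b := fun i =>
      ⟨Finset.mem_of_mem_erase (hb' i), Finset.ne_of_mem_erase (hb' i)⟩
    refine ⟨Fin.cons r r', Fin.cons b b', ?_, ?_, ?_⟩
    · intro i
      refine Fin.cases ?_ (fun i => ?_) i
      · simpa using hr
      · simpa using (hrA i).1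
    · intro i
      refine Fin.cases ?_ (fun i => ?_) i
      · simpa using hb
      · simpa using (hbB i).1
    · intro i j
      refine Fin.cases ?_ (fun i => ?_) i <;> refine Fin.cases ?_ (fun j => ?_) j
      · simp
      · intro _
        simp only [Fin.cons_zero, Fin.cons_succ]
        obtain ⟨hj, hj'⟩ := hrA j
        obtain ⟨hk, hk'⟩ := hbB j
        exact ⟨lt_of_le_of_ne (h1 _ hj) (hgp b (Finset.mem_union_right _ hb) r
            (Finset.mem_union_left _ hr) _ (Finset.mem_union_left _ hj) (hAB r hr b hb).symm
            (hAB _ hj b hb).symm hj'.symm),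
          lt_of_le_of_ne (h2 _ hk) (hgp b (Finset.mem_union_right _ hb) r
            (Finset.mem_union_left _ hr) _ (Finset.mem_union_right _ hk) (hAB r hr b hb).symm
            hk'.symm (hAB r hr _ hk))⟩
      · intro h
        simp at h
      · intro hij
        simpa only [Fin.cons_succ] using h' i j (Fin.succ_lt_succ_iff.1 hij)

/-! ### Choosing the separating line -/

theorem exists_frameY_injOn (S : Finset Plane) : ∃ t, Set.InjOn (frameY t) S := by
  classical
  obtain ⟨t, ht⟩ := Infinite.exists_notMem_finset
    ((S ×ˢ S).image fun z => (z.2.im - z.1.im) / (z.2.re - z.1.re))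
  refine ⟨t, fun x hx y hy hxy => ?_⟩
  simp only [frameY] at hxy
  by_cases hre : y.re - x.re = 0
  · have hre' : y.re = x.re := by linarith
    rw [hre'] at hxy
    apply Complex.ext <;> linarith
  · refine absurd (Finset.mem_image.2 ⟨(x, y), Finset.mem_product.2 ⟨hx, hy⟩, ?_⟩) ht
    rw [div_eq_iff hre]
    linarith

theorem exists_level {F : Finset Plane} {f : Plane → ℝ} (hf : Set.InjOn f F) {n : ℕ}
    (hn : 0 < n) (hnF : n < F.card) :
    ∃ c, (F.filter fun x => c < f x).card = n ∧ ∀ x ∈ F, f x ≠ c := by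
  classical
  obtain ⟨σ, hσ⟩ := exists_equiv_strictAnti (fun x : F => f x)
    (fun x y h => Subtype.ext (hf x.2 y.2 h)) (m := F.card) (by simp)
  set i : Fin F.card := ⟨n - 1, by omega⟩ with hi
  set j : Fin F.card := ⟨n, hnF⟩ with hj
  have hij : f (σ j) < f (σ i) := hσ (show i < j by rw [Fin.lt_def]; simp only [hi, hj]; omega)
  have hdich : ∀ x ∈ F, f (σ i) ≤ f x ∨ f x ≤ f (σ j) := by
    intro x hx
    obtain ⟨l, hl⟩ := σ.surjective ⟨x, hx⟩
    have hx' : f (σ l) = f x := by rw [hl]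
    rw [← hx']
    rcases le_or_gt l i with h | h
    · exact Or.inl (hσ.antitone h)
    · refine Or.inr (hσ.antitone (show j ≤ l from ?_))
      rw [Fin.lt_def] at h
      rw [Fin.le_def]
      simp only [hi] at h
      simp only [hj]
      omega
  refine ⟨(f (σ i) + f (σ j)) / 2, ?_, ?_⟩
  · have hcard := card_lt_of_strictAnti (fun x : F => f x) σ hσ j
    trans (j : ℕ)
    · rw [← hcard, ← Finset.card_map (Function.Embedding.subtype _)]
      congr 1
      ext x
      simp only [Finset.mem_filter, Finset.mem_map, Finset.mem_univ, true_and,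
        Function.Embedding.subtype_apply, Subtype.exists, exists_and_left, exists_prop,
        exists_eq_right_right]
      constructor
      · rintro ⟨hx, h⟩
        exact ⟨by linarith, hx⟩
      · rintro ⟨h, hx⟩
        refine ⟨hx, ?_⟩
        rcases hdich x hx with h' | h' <;> linarith
    · rfl
  · intro x hx h
    rcases hdich x hx with h' | h' <;> linarith

namespace BichromaticSet

variable {S : BichromaticSet}

theorem color_of_mem_red {x : Plane} (hx : x ∈ S.red) : S.color x = PointColor.red := by
  simp [color, hx]

theorem color_of_mem_blue {x : Plane} (hx : x ∈ S.blue) : S.color x = PointColor.blue := by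
  have : x ∉ S.red := fun h => Finset.disjoint_left.1 S.disjoint h hx
  simp [color, this]

theorem card_points {n : ℕ} (hS : S.IsBalanced n) : S.points.card = 2 * n := by
  classical
  rw [points, Finset.card_union_of_disjoint S.disjoint, hS.1, hS.2]
  ring

/-- Some line has at least `n / 2` points of one color on one side and as many points of the other
color on the other side. -/
theorem exists_separated {n : ℕ} (hn : 0 < n) (hS : S.IsBalanced n) :
    ∃ (t c : ℝ) (N : ℕ) (A B : Finset Plane), n ≤ 2 * N ∧ A ⊆ S.points ∧ B ⊆ S.points ∧
      A.card = N ∧ B.card = N ∧ (∀ x ∈ A, c < frameY t x) ∧ (∀ x ∈ B, frameY t x < c) ∧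
      ∀ x ∈ A, ∀ y ∈ B, S.color x ≠ S.color y := by
  classical
  have hcard := card_points hS
  obtain ⟨t, ht⟩ := exists_frameY_injOn S.points
  obtain ⟨c, hc, hne⟩ := exists_level ht hn (by omega)
  have hred : S.red ⊆ S.points := Finset.subset_union_left
  have hblue : S.blue ⊆ S.points := Finset.subset_union_right
  let up : Finset Plane → Finset Plane := fun F => F.filter fun x => c < frameY t x
  let dn : Finset Plane → Finset Plane := fun F => F.filter fun x => ¬ c < frameY t x
  have hup : ∀ F, ∀ x ∈ up F, c < frameY t x := fun F x hx => (Finset.mem_filter.1 hx).2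
  have hdn : ∀ F ⊆ S.points, ∀ x ∈ dn F, frameY t x < c := fun F hF x hx =>
    lt_of_le_of_ne (not_lt.1 (Finset.mem_filter.1 hx).2) (hne x (hF (Finset.mem_filter.1 hx).1))
  have hr : (up S.red).card + (dn S.red).card = n := by
    rw [Finset.card_filter_add_card_filter_not, hS.1]
  have hb : (up S.blue).card + (dn S.blue).card = n := by
    rw [Finset.card_filter_add_card_filter_not, hS.2]
  -- With `hr` and `hb` this gives as many red points above as blue ones below, and vice versa; the
  -- two numbers sum to `n`, so the larger one is at least `n / 2`.
  have hrb : (up S.red).card + (up S.blue).card = n := by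
    rw [← hc, points, Finset.filter_union, Finset.card_union_of_disjoint]
    exact Finset.disjoint_filter_filter S.disjoint
  rcases le_total n (2 * (up S.red).card) with h | h
  · refine ⟨t, c, (up S.red).card, up S.red, dn S.blue, h, (Finset.filter_subset _ _).trans hred,
      (Finset.filter_subset _ _).trans hblue, rfl, by omega, hup _, hdn _ hblue, ?_⟩
    intro x hx y hy
    rw [color_of_mem_red (Finset.mem_filter.1 hx).1, color_of_mem_blue (Finset.mem_filter.1 hy).1]
    simp
  · refine ⟨t, c, (up S.blue).card, up S.blue, dn S.red, by omega,
      (Finset.filter_subset _ _).trans hblue, (Finset.filter_subset _ _).trans hred, rfl,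
      by omega, hup _, hdn _ hred, ?_⟩
    intro x hx y hy
    rw [color_of_mem_blue (Finset.mem_filter.1 hx).1, color_of_mem_red (Finset.mem_filter.1 hy).1]
    simp

end BichromaticSet

/-! ### Building the fan from the matching -/

theorem cross_ne_zero_of_strong {X : Set Plane} (hX : InStrongGeneralPosition X)
    {x y x' y' : Plane} (hx : x ∈ X) (hy : y ∈ X) (hx' : x' ∈ X) (hy' : y' ∈ X) (hxy : x ≠ y)
    (hxy' : x' ≠ y') (hne : ({x, y} : Set Plane) ≠ {x', y'}) :
    cross (y - x) (y' - x') ≠ 0 := by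
  intro h
  apply hX.2 x hx y hy x' hx' y' hy' hxy hxy' hne
  have hd : y - x ≠ 0 := sub_ne_zero.2 hxy.symm
  have hd' : y' - x' ≠ 0 := sub_ne_zero.2 hxy'.symm
  obtain ⟨r, hr⟩ : ∃ r : ℝ, y' - x' = r • (y - x) := by
    have hns : Complex.normSq (y - x) ≠ 0 := by simpa using hd
    refine ⟨((y - x).re * (y' - x').re + (y - x).im * (y' - x').im) / Complex.normSq (y - x), ?_⟩
    rw [div_eq_inv_mul, mul_smul, eq_inv_smul_iff₀ hns]
    unfold cross at h
    apply Complex.ext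
    · simp only [Complex.real_smul, Complex.re_ofReal_mul, Complex.normSq_apply]
      linear_combination (-(y - x).im) * h
    · simp only [Complex.real_smul, Complex.im_ofReal_mul, Complex.normSq_apply]
      linear_combination (y - x).re * h
  have hr0 : r ≠ 0 := by
    rintro rfl
    exact hd' (by simpa using hr)
  rw [AffineSubspace.affineSpan_pair_parallel_iff_vectorSpan_eq, vectorSpan_pair_rev, vectorSpan_pair_rev,
    vsub_eq_sub, vsub_eq_sub, hr, Submodule.span_singleton_smul_eq (IsUnit.mk0 r hr0)]

theorem dir_eq_exp (a : ℝ) : dir a = Complex.exp (a * Complex.I) := by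
  apply Complex.ext
  · rw [Complex.exp_ofReal_mul_I_re]; rfl
  · rw [Complex.exp_ofReal_mul_I_im]; rfl

/-- The argument of `d` is measured from `u`; it could only be `π` if `d` were opposite to `u`. -/
theorem exists_angle {u d : Plane} (h : cross u d ≠ 0) :
    ∃ a : ℝ, |a - Complex.arg u| < Real.pi ∧ ∃ r : ℝ, 0 < r ∧ d = r • dir a := by
  have hu : u ≠ 0 := by rintro rfl; simp [cross] at h
  have hd : d ≠ 0 := by rintro rfl; simp [cross] at h
  refine ⟨Complex.arg u + Complex.arg (d / u), ?_, ‖d‖, norm_pos_iff.2 hd, ?_⟩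
  · rw [add_sub_cancel_left, abs_lt]
    refine ⟨Complex.neg_pi_lt_arg _, lt_of_le_of_ne (Complex.arg_le_pi _) fun he => h ?_⟩
    have h1 := (Complex.arg_eq_pi_iff.1 he).2
    rw [Complex.div_im] at h1
    have hns : Complex.normSq u ≠ 0 := by simpa using hu
    field_simp at h1
    unfold cross
    linarith
  · rw [dir_eq_exp, Complex.ofReal_add, add_mul, Complex.exp_add, Complex.real_smul]
    have h1 := Complex.norm_mul_exp_arg_mul_I u
    have h2 := Complex.norm_mul_exp_arg_mul_I (d / u)
    have h3 : (‖d‖ : ℂ) = ‖u‖ * ‖d / u‖ := by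
      rw [norm_div, Complex.ofReal_div]
      have : (‖u‖ : ℂ) ≠ 0 := by simpa using hu
      field_simp
    calc d = u * (d / u) := by field_simp
      _ = (‖u‖ * Complex.exp (Complex.arg u * Complex.I)) *
          (‖d / u‖ * Complex.exp (Complex.arg (d / u) * Complex.I)) := by rw [h1, h2]
      _ = _ := by rw [h3]; ring

/-- Points can be distributed to the first half-plane that contains them. -/
theorem exists_first_index {X : Type*} {k : ℕ} (hk : 0 < k) (P : Fin k → X → Prop) :
    ∃ g : X → Fin k, (∀ x, ∀ l < g x, ¬ P l x) ∧ (∀ x l, g x < l → P (g x) x) ∧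
      ∀ x i, P i x → (∀ l < i, ¬ P l x) → g x = i := by
  have h : ∀ x, ∃ i : Fin k, (P i x ∨ ∀ l, l ≤ i) ∧ ∀ l < i, ¬ (P l x ∨ ∀ m, m ≤ l) := by
    intro x
    obtain ⟨i, hi, hmin⟩ := wellFounded_lt.has_min {i : Fin k | P i x ∨ ∀ l, l ≤ i}
      ⟨⟨k - 1, by omega⟩, Or.inr fun l => by rw [Fin.le_def]; simp only; omega⟩
    exact ⟨i, hi, fun l hl h => hmin l h hl⟩
  choose g hg1 hg2 using h
  have hlt : ∀ x l, g x < l → P (g x) x := fun x l hl =>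
    (hg1 x).resolve_right fun h => (h l).not_gt hl
  refine ⟨g, fun x l hl h => hg2 x l hl (Or.inl h), hlt, fun x i hi hmin => ?_⟩
  rcases lt_trichotomy (g x) i with h | h | h
  · exact absurd (hlt x i h) (hmin _ h)
  · exact h
  · exact absurd (Or.inl hi) (hg2 x i h)

theorem BichromaticSet.exists_two_pow_le {S : BichromaticSet} {n : ℕ} (hn : 0 < n)
    (hS : S.IsBalanced n) (hgp : InStrongGeneralPosition (S.points : Set Plane)) :
    ∃ k : ℕ, n ≤ k * (k + 1) ∧ 2 ^ k ≤ 2 * n * S.gamma := by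
  classical
  have hcard := card_points hS
  obtain ⟨t, c, N, A, B, hN, hAS, hBS, hAc, hBc, hA, hB, hcol⟩ := exists_separated hn hS
  have hstrong : ∀ x ∈ S.points, ∀ y ∈ S.points, ∀ x' ∈ S.points, ∀ y' ∈ S.points, x ≠ y →
      x' ≠ y' → ({x, y} : Set Plane) ≠ {x', y'} → cross (y - x) (y' - x') ≠ 0 :=
    fun x hx y hy x' hx' y' hy' => cross_ne_zero_of_strong hgp hx hy hx' hy'
  have hABS : A ∪ B ⊆ S.points := Finset.union_subset hAS hBS
  obtain ⟨r, b, hr, hb, hord⟩ := exists_ordered_matching t c N A B hAc hBc hA hB (by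
    intro x hx y hy z hz hxy hxz hyz
    apply hstrong x (hABS hx) y (hABS hy) x (hABS hx) z (hABS hz) hxy hxz
    intro h
    have : y ∈ ({x, z} : Set Plane) := h ▸ (by simp)
    rcases this with h | h
    · exact hxy h.symm
    · exact hyz h)
  have hrS : ∀ i, r i ∈ S.points := fun i => hAS (hr i)
  have hbS : ∀ i, b i ∈ S.points := fun i => hBS (hb i)
  let V : Fin N → Plane := fun i => r i - b i
  have hVY : ∀ i, 0 < frameY t (V i) := fun i => by
    simp only [V, frameY_sub]
    linarith [hA _ (hr i), hB _ (hb i)]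
  have hrb : ∀ i, r i ≠ b i := fun i h => by
    have := hA _ (hr i)
    rw [h] at this
    exact lt_asymm this (hB _ (hb i))
  have hVV : ∀ i, cross (V i) (V i) = 0 := fun i => by unfold cross; ring
  have ht : 0 < 1 + t ^ 2 := by positivity
  have hne : ∀ i j, i < j → cross (V i) (V j) ≠ 0 := by
    intro i j hij
    refine hstrong (b i) (hbS i) (r i) (hrS i) (b j) (hbS j) (r j) (hrS j) (hrb i).symm
      (hrb j).symm fun h => ?_
    have h1 := (hord i j hij).1
    have : r j ∈ ({b i, r i} : Set Plane) := h ▸ (by simp)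
    rcases this with h | h
    · rw [h, sub_self] at h1
      simp [cross] at h1
    · rw [h] at h1
      exact h1.ne (hVV i)
  -- How far the upward edge leans to the right: the cotangent of its angle with the separating
  -- line.
  let s : Fin N → ℝ := fun i => frameX t (V i) / frameY t (V i)
  have hs_lt : ∀ i j, s i < s j → cross (V i) (V j) < 0 := by
    intro i j h
    rw [div_lt_div_iff₀ (hVY i) (hVY j)] at h
    have := frame_cross t (V i) (V j)
    by_contra hpos
    nlinarith [mul_nonneg ht.le (not_lt.1 hpos)]
  have hcross_symm : ∀ x y, cross x y = -cross y x := fun x y => by unfold cross; ring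
  have hs_inj : Function.Injective s := by
    have key : ∀ i j, i < j → s i ≠ s j := by
      intro i j hij h
      rw [div_eq_div_iff (hVY i).ne' (hVY j).ne'] at h
      have h1 := frame_cross t (V i) (V j)
      have h2 : (1 + t ^ 2) * cross (V i) (V j) = 0 := by rw [h1]; linarith
      exact hne i j hij ((mul_eq_zero.1 h2).resolve_left ht.ne')
    intro i j h
    rcases lt_trichotomy i j with h' | h' | h'
    · exact absurd h (key i j h')
    · exact h'
    · exact absurd h.symm (key j i h')
  obtain ⟨K, hK, hrec⟩ := exists_records s hs_inj
  refine ⟨K.card, by omega, ?_⟩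
  have hk : 0 < K.card := by
    rcases Nat.eq_zero_or_pos K.card with h | h
    · rw [h] at hK
      omega
    · exact h
  let f : Fin K.card ↪o Fin N := K.orderEmbOfFin rfl
  have hfK : ∀ i, f i ∈ K := fun i => K.orderEmbOfFin_mem rfl i
  -- A record to the right is directed upward, a record to the left downward; either way `η j • V (f
  -- j)` points to the right of all earlier edges.
  have hη : ∀ j : Fin K.card, ∃ η : ℝ, (η = 1 ∨ η = -1) ∧
      ∀ i < j, η * cross (V (f i)) (V (f j)) < 0 := by
    intro j
    rcases hrec (f j) (hfK j) with h | h
    · refine ⟨1, Or.inl rfl, fun i hij => ?_⟩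
      have := hs_lt _ _ (h (f i) (hfK i) (f.lt_iff_lt.2 hij))
      linarith
    · refine ⟨-1, Or.inr rfl, fun i hij => ?_⟩
      have := hs_lt _ _ (h (f i) (hfK i) (f.lt_iff_lt.2 hij))
      rw [hcross_symm] at this
      linarith
  choose η hη1 hη2 using hη
  have hends : ∀ j : Fin K.card, ∃ p q : Plane, q - p = η j • V (f j) ∧
      (p = b (f j) ∧ q = r (f j) ∨ p = r (f j) ∧ q = b (f j)) := by
    intro j
    rcases hη1 j with h | h
    · exact ⟨_, _, by rw [h, one_smul], Or.inl ⟨rfl, rfl⟩⟩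
    · exact ⟨_, _, by rw [h, neg_one_smul, neg_sub], Or.inr ⟨rfl, rfl⟩⟩
  choose p q hpqV hpq using hends
  have hη0 : ∀ j, η j * η j = 1 := fun j => by rcases hη1 j with h | h <;> rw [h] <;> norm_num
  -- The direction of the separating line. Every edge crosses that line, so no ray points along `-u`
  -- and the circle can be cut there.
  let u : Plane := ⟨1, t⟩
  have hu : ∀ x, cross u x = frameY t x := fun x => by simp only [cross, frameY, u]; ring
  have hang : ∀ j : Fin K.card, ∃ a : ℝ, |a - Complex.arg u| < Real.pi ∧
      ∃ ρ : ℝ, 0 < ρ ∧ q j - p j = ρ • dir a := by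
    intro j
    apply exists_angle
    rw [hpqV, cross_smul_right, hu]
    refine mul_ne_zero (fun h => ?_) (hVY _).ne'
    have := hη0 j
    rw [h] at this
    norm_num at this
  choose α hα ρ hρ hdir using hang
  have hdirV : ∀ j x, ρ j * cross (dir (α j)) x = η j * cross (V (f j)) x := by
    intro j x
    rw [← cross_smul_left, ← hdir, hpqV, cross_smul_left]
  obtain ⟨g, hg1, hg2, hg3⟩ := exists_first_index hk
    (fun i x => 0 ≤ cross (V (f i)) (x - b (f i)))
  have hgb : ∀ j, g (b (f j)) = j := by
    intro j
    refine hg3 _ _ ?_ fun l hl => not_le.2 (hord _ _ (f.lt_iff_lt.2 hl)).2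
    simp [cross]
  have hgr : ∀ j, g (r (f j)) = j := fun j =>
    hg3 _ _ (hVV (f j)).ge fun l hl => not_le.2 (hord _ _ (f.lt_iff_lt.2 hl)).1
  have hcolrb : ∀ j, S.color (r j) ≠ S.color (b j) := fun j => hcol _ (hr j) _ (hb j)
  have hpq_ne : ∀ j, p j ≠ q j := by
    intro j
    rcases hpq j with ⟨h1, h2⟩ | ⟨h1, h2⟩ <;> rw [h1, h2]
    · exact (hrb _).symm
    · exact hrb _
  have hpS : ∀ j, p j ∈ S.points := by
    intro j
    rcases hpq j with ⟨h1, -⟩ | ⟨h1, -⟩ <;> rw [h1]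
    exacts [hbS _, hrS _]
  have hqS : ∀ j, q j ∈ S.points := by
    intro j
    rcases hpq j with ⟨-, h1⟩ | ⟨-, h1⟩ <;> rw [h1]
    exacts [hrS _, hbS _]
  rw [← hcard]
  -- The right side of `V (f i)` is where `cross` is negative, and `dir (α i)` is a positive
  -- multiple of `η i • V (f i)`; hence the sign `-η i`.
  apply two_pow_le_of_fan (g := g) (φ := Complex.arg u) (α := α) (t := fun i => -η i) (p := p)
    (q := q) hpS hqS ?_ ?_ ?_ (by omega) hα ?_ ?_ ?_ (fun i => ⟨ρ i, hρ i, hdir i⟩)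
  · intro j
    rcases hpq j with ⟨h1, -⟩ | ⟨h1, -⟩ <;> rw [h1]
    exacts [hgb _, hgr _]
  · intro j
    rcases hpq j with ⟨-, h1⟩ | ⟨-, h1⟩ <;> rw [h1]
    exacts [hgr _, hgb _]
  · intro j
    rcases hpq j with ⟨h1, h2⟩ | ⟨h1, h2⟩ <;> rw [h1, h2]
    exacts [(hcolrb _).symm, hcolrb _]
  · intro x _ y _ hxy
    have h1 := hg2 x (g y) hxy
    have h2 := not_le.1 (hg1 y (g x) hxy)
    have h3 := hdirV (g x) (y - x)
    have h4 : cross (V (f (g x))) (y - x) < 0 := by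
      rw [cross_sub_right] at h1 h2 ⊢
      linarith
    have h5 : ρ (g x) * (-η (g x) * cross (dir (α (g x))) (y - x)) =
        -cross (V (f (g x))) (y - x) := by
      linear_combination -η (g x) * h3 - cross (V (f (g x))) (y - x) * hη0 (g x)
    exact (mul_pos_iff_of_pos_left (hρ (g x))).1 (by rw [h5]; linarith)
  · intro i j hij
    have h3 := hdirV i (dir (α j))
    have h4 := hdirV j (V (f i))
    have h5 := hη2 j i hij
    rw [hcross_symm _ (V (f i)), hcross_symm _ (V (f i))] at h4
    have h6 : ρ i * (ρ j * (-η i * cross (dir (α i)) (dir (α j)))) =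
        -(η j * cross (V (f i)) (V (f j))) := by
      linear_combination (-η i * ρ j) * h3 - ρ j * cross (V (f i)) (dir (α j)) * hη0 i + h4
    exact (mul_pos_iff_of_pos_left (hρ j)).1
      ((mul_pos_iff_of_pos_left (hρ i)).1 (by rw [h6]; linarith))
  · intro x hx y hy hxy hgxy h
    have h1 : cross (q (g x) - p (g x)) (y - x) = 0 := by
      rw [hdir, cross_smul_left, cross_sub_right, h, sub_self, mul_zero]
    -- A different pair would span a line parallel to the edge.
    have h2 : ({p (g x), q (g x)} : Set Plane) = {x, y} := by
      by_contra hne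
      exact hstrong _ (hpS _) _ (hqS _) x hx y hy (hpq_ne _) hxy hne h1
    have hx' : x ∈ ({p (g x), q (g x)} : Set Plane) := h2 ▸ (by simp)
    have hy' : y ∈ ({p (g x), q (g x)} : Set Plane) := h2 ▸ (by simp)
    exact ⟨hx', hy'⟩

/-! ### Existence of sets in strong general position -/

/-- The points `(2 ^ i, 4 ^ i)` of a parabola. -/
noncomputable def parabolaPoint (i : ℕ) : Plane := ⟨2 ^ i, (2 ^ i) ^ 2⟩

theorem parabolaPoint_injective : Function.Injective parabolaPoint := by
  intro i j h
  have h1 : (2 : ℝ) ^ i = 2 ^ j := congrArg Complex.re h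
  exact pow_right_injective₀ (by norm_num) (by norm_num) h1

/-- The larger exponent is determined by the size of the sum. These sums are the slopes of the
chords of the parabola, so distinct chords are not parallel. -/
theorem two_pow_add_two_pow_inj {a b c d : ℕ} (hab : a < b) (hcd : c < d)
    (h : 2 ^ a + 2 ^ b = 2 ^ c + 2 ^ d) : a = c ∧ b = d := by
  have hb : 2 ^ a < 2 ^ b := Nat.pow_lt_pow_right (by norm_num) hab
  have hd : 2 ^ c < 2 ^ d := Nat.pow_lt_pow_right (by norm_num) hcd
  have hbd : b = d := by
    rcases lt_trichotomy b d with hlt | h' | hlt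
    · have := Nat.pow_le_pow_right (n := 2) (by norm_num) (show b + 1 ≤ d from hlt)
      rw [pow_succ] at this
      have := Nat.two_pow_pos c
      omega
    · exact h'
    · have := Nat.pow_le_pow_right (n := 2) (by norm_num) (show d + 1 ≤ b from hlt)
      rw [pow_succ] at this
      have := Nat.two_pow_pos a
      omega
  subst hbd
  exact ⟨Nat.pow_right_injective (le_refl 2) (by simpa using h), rfl⟩

theorem cross_parabolaPoint (a b c d : ℕ) :
    cross (parabolaPoint b - parabolaPoint a) (parabolaPoint d - parabolaPoint c) =
      (2 ^ b - 2 ^ a) * (2 ^ d - 2 ^ c) * ((2 ^ c + 2 ^ d) - (2 ^ a + 2 ^ b)) := by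
  simp only [cross, parabolaPoint, Complex.sub_re, Complex.sub_im]
  ring

theorem cross_eq_zero_of_parallel {x y x' y' : Plane}
    (h : (affineSpan ℝ ({x, y} : Set Plane)).Parallel (affineSpan ℝ ({x', y'} : Set Plane))) :
    cross (y - x) (y' - x') = 0 := by
  rw [AffineSubspace.affineSpan_pair_parallel_iff_vectorSpan_eq, vectorSpan_pair_rev,
    vectorSpan_pair_rev, vsub_eq_sub, vsub_eq_sub] at h
  have h1 : y' - x' ∈ Submodule.span ℝ {y - x} := h ▸ Submodule.mem_span_singleton_self _
  obtain ⟨r, hr⟩ := Submodule.mem_span_singleton.1 h1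
  rw [← hr, cross_smul_right]
  unfold cross
  ring

theorem cross_eq_zero_of_collinear {x y z : Plane} (h : Collinear ℝ ({x, y, z} : Set Plane)) :
    cross (y - x) (z - x) = 0 := by
  obtain ⟨v, hv⟩ := (collinear_iff_of_mem (p₀ := x) (by simp)).1 h
  obtain ⟨r, hr⟩ := hv y (by simp)
  obtain ⟨s, hs⟩ := hv z (by simp)
  rw [hr, hs, vadd_eq_add, vadd_eq_add, add_sub_cancel_right, add_sub_cancel_right,
    cross_smul_left, cross_smul_right]
  unfold cross
  ring

theorem cross_parabolaPoint_ne_zero {a b c d : ℕ} (hab : a ≠ b) (hcd : c ≠ d)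
    (h : ¬ (a = c ∧ b = d)) (h' : ¬ (a = d ∧ b = c)) :
    cross (parabolaPoint b - parabolaPoint a) (parabolaPoint d - parabolaPoint c) ≠ 0 := by
  have hinj : ∀ i j : ℕ, i ≠ j → (2 : ℝ) ^ j - 2 ^ i ≠ 0 := fun i j hij =>
    sub_ne_zero.2 fun he => hij (pow_right_injective₀ (by norm_num) (by norm_num) he).symm
  rw [cross_parabolaPoint]
  refine mul_ne_zero (mul_ne_zero (hinj _ _ hab) (hinj _ _ hcd)) fun he => ?_
  have hN : 2 ^ a + 2 ^ b = 2 ^ c + 2 ^ d := by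
    have : (2 : ℝ) ^ a + 2 ^ b = 2 ^ c + 2 ^ d := by linarith
    exact_mod_cast this
  rcases lt_or_gt_of_ne hab with h1 | h1 <;> rcases lt_or_gt_of_ne hcd with h2 | h2
  · exact h (two_pow_add_two_pow_inj h1 h2 hN)
  · exact h' (two_pow_add_two_pow_inj h1 h2 (by omega))
  · have := two_pow_add_two_pow_inj h1 h2 (by omega)
    exact h' ⟨this.2, this.1⟩
  · have := two_pow_add_two_pow_inj h1 h2 (by omega)
    exact h ⟨this.2, this.1⟩

theorem inStrongGeneralPosition_parabola :
    InStrongGeneralPosition (Set.range parabolaPoint) := by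
  constructor
  · rintro _ ⟨a, rfl⟩ _ ⟨b, rfl⟩ _ ⟨c, rfl⟩ hab hac hbc h
    have hab' : a ≠ b := fun h => hab (h ▸ rfl)
    have hac' : a ≠ c := fun h => hac (h ▸ rfl)
    have hbc' : b ≠ c := fun h => hbc (h ▸ rfl)
    exact cross_parabolaPoint_ne_zero hab' hac' (fun h => hbc' h.2) (fun h => hac' h.1)
      (cross_eq_zero_of_collinear h)
  · rintro _ ⟨a, rfl⟩ _ ⟨b, rfl⟩ _ ⟨c, rfl⟩ _ ⟨d, rfl⟩ hab hcd hne h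
    have hab' : a ≠ b := fun h => hab (h ▸ rfl)
    have hcd' : c ≠ d := fun h => hcd (h ▸ rfl)
    refine cross_parabolaPoint_ne_zero hab' hcd' ?_ ?_ (cross_eq_zero_of_parallel h)
    · rintro ⟨rfl, rfl⟩
      exact hne rfl
    · rintro ⟨rfl, rfl⟩
      exact hne (Set.pair_comm _ _)

theorem InStrongGeneralPosition.mono {X Y : Set Plane} (hX : InStrongGeneralPosition X)
    (h : Y ⊆ X) : InStrongGeneralPosition Y :=
  ⟨fun p hp q hq r hr => hX.1 p (h hp) q (h hq) r (h hr),
    fun p hp q hq p' hp' q' hq' => hX.2 p (h hp) q (h hq) p' (h hp') q' (h hq')⟩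

/-- Needed for the bound on `gammaMinSgp`, as the infimum of an empty set of naturals is `0`. -/
theorem BichromaticSet.exists_strong (n : ℕ) : ∃ S : BichromaticSet, S.IsBalanced n ∧
    InStrongGeneralPosition (S.points : Set Plane) := by
  classical
  let e : ℕ ↪ Plane := ⟨parabolaPoint, parabolaPoint_injective⟩
  refine ⟨⟨(Finset.range n).map e, (Finset.Ico n (2 * n)).map e, ?_⟩, ⟨by simp, ?_⟩, ?_⟩
  · rw [Finset.disjoint_map, Finset.disjoint_left]
    intro i hi hi'
    simp only [Finset.mem_range, Finset.mem_Ico] at hi hi'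
    omega
  · simp only [Finset.card_map, Nat.card_Ico]
    omega
  · refine inStrongGeneralPosition_parabola.mono fun x hx => ?_
    simp only [points, Finset.coe_union, Finset.coe_map, Set.mem_union, Set.mem_image] at hx
    rcases hx with ⟨i, -, rfl⟩ | ⟨i, -, rfl⟩ <;> exact ⟨i, rfl⟩

/-! ### The final estimates -/

theorem BichromaticSet.le_gamma {S : BichromaticSet} {n : ℕ} (hn : 1 ≤ n)
    (hS : S.IsBalanced n) (hgp : InStrongGeneralPosition (S.points : Set Plane)) :
    1 / 4 * ((2 : ℝ) ^ Real.sqrt (n : ℝ) / (n : ℝ)) ≤ (S.gamma : ℝ) := by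
  obtain ⟨k, hk, hγ⟩ := exists_two_pow_le hn hS hgp
  have hn' : (0 : ℝ) < n := by exact_mod_cast hn
  -- From `n ≤ k * (k + 1)`. The extra `1` in the exponent costs a factor `2`, which with the `2 *
  -- n` rotations gives the constant `1 / 4`.
  have hsq : √(n : ℝ) ≤ (k + 1 : ℕ) := by
    apply Real.sqrt_le_iff.2 ⟨by positivity, ?_⟩
    have : n ≤ (k + 1) ^ 2 := by nlinarith
    exact_mod_cast this
  have h1 : (2 : ℝ) ^ √(n : ℝ) ≤ 2 ^ (k + 1) := by
    rw [← Real.rpow_natCast]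
    exact Real.rpow_le_rpow_of_exponent_le (by norm_num) hsq
  have h2 : (2 : ℝ) ^ k ≤ 2 * n * S.gamma := by exact_mod_cast hγ
  rw [mul_div_assoc', div_le_iff₀ hn']
  rw [pow_succ] at h1
  linarith

theorem mainTheorem1 :
    (∃ c : ℝ, 0 < c ∧ ∃ n₀ : ℕ, ∀ n : ℕ, n₀ ≤ n →
      ∀ S : BichromaticSet, S.IsBalanced n →
        InStrongGeneralPosition (S.points : Set Plane) →
          c * ((2 : ℝ) ^ Real.sqrt (n : ℝ) / (n : ℝ)) ≤ (S.gamma : ℝ)) ∧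
    (∃ c : ℝ, 0 < c ∧ ∃ n₀ : ℕ, ∀ n : ℕ, n₀ ≤ n →
      c * ((2 : ℝ) ^ Real.sqrt (n : ℝ) / (n : ℝ)) ≤ (gammaMinSgp n : ℝ)) := by
  refine ⟨⟨1 / 4, by norm_num, 1, fun n hn S hS hgp => S.le_gamma hn hS hgp⟩,
    ⟨1 / 4, by norm_num, 1, fun n hn => ?_⟩⟩
  obtain ⟨S₀, hS₀, hgp₀⟩ := BichromaticSet.exists_strong n
  obtain ⟨S, hS, hgp, hγ⟩ := Nat.sInf_mem
    (s := {k : ℕ | ∃ S : BichromaticSet, S.IsBalanced n ∧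
      InStrongGeneralPosition (S.points : Set Plane) ∧ S.gamma = k}) ⟨_, S₀, hS₀, hgp₀, rfl⟩
  rw [gammaMinSgp, ← hγ]
  exact BichromaticSet.le_gamma hn hS hgp
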